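/- Let $X$ be a standard Borel space and $\mathcal R$ a Borel equivalence relation on $X$ with countable classes. Definitions. A Borel equivalence relation on a standard Borel space is *smooth* if it admits a fundamental domain, i.e. a Borel set meeting each class in exactly one point. $\mathcal R$ is *treeable* if there is a Borel graph on $X$ (a symmetric irreflexive Borel subset of $X\times X$) that is acyclic and whose connected components are exactly the $\mathcal R$-classes. An *$\mathcal R$-space* is a standard Borel space $F$ with a countable-to-one Borel map $\pi:F\to X$ and a Borel map $((x,y),t)\mapsto (x,y)\cdot t\in F$, defined for $(x,y)\in\mathcal R$ and $\pi(t)=y$, such that $\pi((x,y)\cdot t)=x$, $(z,z)\cdot t=t$ and $(x,y)\cdot((y,z)\cdot t)=(x,z)\cdot t$. Then $\mathcal R_F$ is the equivalence relation on $F$ for which $f,g$ are equivalent iff $(\pi(f),\pi(g))\in\mathcal R$ and $(\pi(f),\pi(g))\cdot g=f$. A *partial section* is a Borel map $s:A\to F$ on a Borel set $A\subseteq X$ with $\pi\circ s=\mathrm{id}_A$; its *stabilizer* is the relation on $A$ identifying $x,y$ iff $s(x)\mathrel{\mathcal R_F}s(y)$. The action on $F$ is *quasi-free* if the stabilizer of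 every partial section is smooth. An *$\mathcal R$-arboretum* consists of two $\mathcal R$-spaces $\mathcal A^0$ (vertices, with surjective projection) and $\mathcal A^1$ (oriented edges; fibres may be empty) and Borel, fibre-preserving, $\mathcal R$-equivariant maps origin, terminus $\mathcal A^1\to\mathcal A^0$ and edge reversal $\mathcal A^1\to\mathcal A^1$ (a fixed-point-free involution exchanging origin and terminus) such that for every $x\in X$ the graph $\mathcal A_x$ formed by the fibres over $x$ is a tree. $\mathcal R$ acts quasi-freely on $\mathcal A$ if it acts quasi-freely on $\mathcal A^0$. Theorem. $\mathcal R$ is treeable if and only if there exists an $\mathcal R$-arboretum on which $\mathcal R$ acts quasi-freely. Moreover, the action of $\mathcal R$ on an $\mathcal R$-space $F$ is quasi-free if and only if $\mathcal R_F$ is smooth; in particular, quasi-freeness on an arboretum $\mathcal A$ means that $\mathcal R_{\mathcal A^0}$ is smooth. -/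

import Mathlib

universe u

namespace BorelTrees

/-- A countable Borel equivalence relation: Borel as a subset of `X × X`, with countable classes. -/
structure IsCountableBorel {X : Type u} [MeasurableSpace X] (R : Setoid X) : Prop where
  measurableSet : MeasurableSet {p : X × X | R p.1 p.2}
  countable : ∀ x, {y | R x y}.Countable

/-- A fundamental domain: a Borel set meeting every class in exactly one point. -/
def IsFundamentalDomain {Y : Type u} [MeasurableSpace Y] (S : Setoid Y) (D : Set Y) : Prop :=
  MeasurableSet D ∧ ∀ y, ∃! d, d ∈ D ∧ S y d

/-- A relation is smooth if it has a (Borel) fundamental domain. -/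
def IsSmooth {Y : Type u} [MeasurableSpace Y] (S : Setoid Y) : Prop :=
  ∃ D, IsFundamentalDomain S D

/-- `G` is a treeing of `R`: a Borel graph on `X`, without cycles, whose connected components are
exactly the classes of `R`. -/
structure IsTreeing {X : Type u} [MeasurableSpace X] (R : Setoid X) (G : SimpleGraph X) :
    Prop where
  measurableSet : MeasurableSet {p : X × X | G.Adj p.1 p.2}
  reachable_iff : ∀ x y, G.Reachable x y ↔ R x y
  isAcyclic : G.IsAcyclic

/-- `R` is treeable if it admits a treeing. -/
def IsTreeable {X : Type u} [MeasurableSpace X] (R : Setoid X) : Prop :=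
  ∃ G : SimpleGraph X, IsTreeing R G

/-- A standard Borel space `F` with a countable-to-one Borel projection to `X`, together with a
left action of `R`: for `(x, y) ∈ R` and `t` in the fibre of `y`, the point `(x, y) · t` is
`act x y t`, in the fibre of `x`. Empty fibres are allowed here (the edge space of a one-vertex tree
is empty); surjectivity of the projection is a separate condition. -/
structure RSpace {X : Type u} [MeasurableSpace X] (R : Setoid X) where
  carrier : Type u
  [measurableSpace : MeasurableSpace carrier]
  [standardBorel : StandardBorelSpace carrier]
  proj : carrier → X
  measurable_proj : Measurable proj
  countable_fibre : ∀ x, (proj ⁻¹' {x}).Countable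
  act : ∀ (x y : X) (t : carrier), R x y → proj t = y → carrier
  measurable_act : Measurable
    (fun q : {q : (X × X) × carrier // R q.1.1 q.1.2 ∧ proj q.2 = q.1.2} =>
      act q.1.1.1 q.1.1.2 q.1.2 q.2.1 q.2.2)
  proj_act : ∀ x y t (h : R x y) (ht : proj t = y), proj (act x y t h ht) = x
  act_self : ∀ z t (ht : proj t = z), act z z t (R.refl z) ht = t
  act_act : ∀ x y z t (hxy : R x y) (hyz : R y z) (ht : proj t = z),
    act x y (act y z t hyz ht) hxy (proj_act y z t hyz ht) = act x z t (R.trans hxy hyz) ht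

attribute [instance] RSpace.measurableSpace RSpace.standardBorel

namespace RSpace

variable {X : Type u} [MeasurableSpace X] {R : Setoid X}

/-- The relation `R_F` on `F` generated by the action: `f ~ g` iff `(π f, π g) · g = f`. -/
def orbitRel (F : RSpace R) : Setoid F.carrier where
  r f g := ∃ h : R (F.proj f) (F.proj g), F.act (F.proj f) (F.proj g) g h rfl = f
  iseqv := by
    refine ⟨fun f => ⟨R.refl _, F.act_self _ _ _⟩, ?_, ?_⟩
    · rintro f g ⟨h, e⟩
      refine ⟨R.symm h, ?_⟩
      have := F.act_act (F.proj g) (F.proj f) (F.proj g) g (R.symm h) h rfl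
      rw [F.act_self] at this
      simpa only [e] using this
    · rintro f g k ⟨h, e⟩ ⟨h', e'⟩
      refine ⟨R.trans h h', ?_⟩
      have := F.act_act (F.proj f) (F.proj g) (F.proj k) k h h' rfl
      rw [← this]
      simpa only [e'] using e

/-- `s` is a partial Borel section of `F`, defined on the Borel set `A ⊆ X`. -/
structure IsPartialSection (F : RSpace R) (A : Set X) (s : A → F.carrier) : Prop where
  measurableSet_domain : MeasurableSet A
  measurable : Measurable s
  proj_eq : ∀ a : A, F.proj (s a) = a

/-- The stabilizer of a partial section `s : A → F`: the relation on `A` identifying `x` and `y`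
when `s x` and `s y` are `R_F`-equivalent. -/
def stabilizer (F : RSpace R) {A : Set X} (s : A → F.carrier) : Setoid A :=
  F.orbitRel.comap s

/-- The action is quasi-free if the stabilizer of every partial section is smooth. -/
def IsQuasiFree (F : RSpace R) : Prop :=
  ∀ (A : Set X) (s : A → F.carrier), F.IsPartialSection A s → IsSmooth (F.stabilizer s)

/-- The action is smooth if `R_F` is smooth. -/
def IsSmoothAction (F : RSpace R) : Prop :=
  IsSmooth F.orbitRel

/-- A morphism: a Borel, fibre-preserving, `R`-equivariant map. -/
structure IsMorphism (F F' : RSpace R) (f : F.carrier → F'.carrier) : Prop where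
  measurable : Measurable f
  proj_eq : ∀ t, F'.proj (f t) = F.proj t
  map_act : ∀ x y t (h : R x y) (ht : F.proj t = y),
    f (F.act x y t h ht) = F'.act x y (f t) h ((proj_eq t).trans ht)

end RSpace

/-- A Borel field of graphs with an action of `R`. Graphs are given by oriented edges, with origin,
terminus and a fixed-point-free edge reversal. -/
structure GraphField {X : Type u} [MeasurableSpace X] (R : Setoid X) where
  vert : RSpace R
  edge : RSpace R
  vert_surjective : Function.Surjective vert.proj
  origin : edge.carrier → vert.carrier
  terminus : edge.carrier → vert.carrier
  rev : edge.carrier → edge.carrier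
  origin_morphism : edge.IsMorphism vert origin
  terminus_morphism : edge.IsMorphism vert terminus
  rev_morphism : edge.IsMorphism edge rev
  rev_rev : ∀ e, rev (rev e) = e
  rev_ne : ∀ e, rev e ≠ e
  origin_rev : ∀ e, origin (rev e) = terminus e

namespace GraphField

variable {X : Type u} [MeasurableSpace X] {R : Setoid X}

/-- The simple graph underlying the fibre over `x`: two distinct vertices in the fibre are
adjacent when some edge joins them. -/
def fibreGraph (A : GraphField R) (x : X) : SimpleGraph {v : A.vert.carrier // A.vert.proj v = x} where
  Adj v w := v ≠ w ∧ ∃ e, A.origin e = v ∧ A.terminus e = w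
  symm := ⟨by
    rintro v w ⟨hne, e, h₁, h₂⟩
    refine ⟨hne.symm, A.rev e, (A.origin_rev e).trans h₂, ?_⟩
    rw [← A.origin_rev, A.rev_rev, h₁]⟩
  loopless := ⟨fun _ h => h.1 rfl⟩

/-- All fibres are trees: no loop (circuit of length 1), no two distinct edges with the same origin
and terminus (circuit of length 2), and the underlying simple graph of every fibre is a tree
(nonempty, connected, without circuits of length at least 3). -/
structure IsArboretum (A : GraphField R) : Prop where
  no_loop : ∀ e, A.origin e ≠ A.terminus e
  no_multiple : ∀ e e', A.origin e = A.origin e' → A.terminus e = A.terminus e' → e = e'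
  isTree : ∀ x, (A.fibreGraph x).IsTree

/-- `R` acts quasi-freely on a field of graphs if it does so on the vertex space. -/
def IsQuasiFree (A : GraphField R) : Prop :=
  A.vert.IsQuasiFree

end GraphField

end BorelTrees

/-! A treeing restricted to the class of `x` is a tree. Placing a copy of it over every `x` gives an
arboretum whose vertex space is `R` itself, acted on through the first coordinate. Its orbits
consist of the pairs with a given second coordinate, so the diagonal is a fundamental domain.

Conversely, let `D` be a fundamental domain for the orbit relation on the vertices of an arboretum.
The action identifies the trees over the points of one `R`-class, so the quotient is a forest with
one tree per class. Realizing it on `D` and hanging every other vertex as a leaf on its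
representative (`transversalGraph`) trees the pullback of `R` to the vertex space. A Borel section
of the projection is a complete section of this pullback, and treeability passes to complete
sections (`IsTreeable.comap`): points move along edges until they reach the section, and contracting
the connected fibres of the resulting retraction leaves a forest (`contraction_isAcyclic`).

Borelness, and the equivalence of quasi-free and smooth, rest on Lusin–Novikov: the domain of a
countable-to-one Borel map is a countable union of Borel sets on which the map is injective. If this
failed for a continuous map, finite families of open sets, all meeting a common fibre, could be
refined for ever, and a Cantor set of limits would lie in a single fibre. -/

open Set MeasureTheory Topology
namespace BorelTrees

/-! ### Continuous countable-to-one maps: the Cantor scheme behind Lusin–Novikov. -/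

section LusinNovikov

/-- `A` is covered by countably many measurable sets on which `f` is injective. -/
def IsSigmaInjOn {Z X : Type*} [MeasurableSpace Z] (f : Z → X) (A : Set Z) : Prop :=
  ∃ C : Set (Set Z), C.Countable ∧ (∀ c ∈ C, MeasurableSet c ∧ InjOn f c) ∧ A ⊆ ⋃₀ C

namespace IsSigmaInjOn

variable {Z X : Type*} [MeasurableSpace Z] {f : Z → X}

theorem mono {A B : Set Z} (h : IsSigmaInjOn f B) (hAB : A ⊆ B) : IsSigmaInjOn f A := by
  obtain ⟨C, hC, hC', hB⟩ := h
  exact ⟨C, hC, hC', hAB.trans hB⟩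

theorem of_injOn {A : Set Z} (hA : MeasurableSet A) (h : InjOn f A) : IsSigmaInjOn f A :=
  ⟨{A}, countable_singleton A, by simp [hA, h], by simp⟩

theorem iUnion {ι : Sort*} [Countable ι] {A : ι → Set Z} (h : ∀ i, IsSigmaInjOn f (A i)) :
    IsSigmaInjOn f (⋃ i, A i) := by
  choose C hC hC' hA using h
  refine ⟨⋃ i, C i, countable_iUnion hC, ?_, ?_⟩
  · intro c hc
    obtain ⟨i, hi⟩ := mem_iUnion.1 hc
    exact hC' i c hi
  · refine iUnion_subset fun i => (hA i).trans ?_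
    exact sUnion_subset_sUnion (subset_iUnion C i)

theorem union {A B : Set Z} (hA : IsSigmaInjOn f A) (hB : IsSigmaInjOn f B) :
    IsSigmaInjOn f (A ∪ B) := by
  rw [union_eq_iUnion]
  exact iUnion fun b => by cases b <;> assumption

end IsSigmaInjOn

/-- Finitely many analytic sets with empty intersection are contained in Borel sets with empty
intersection. -/
theorem exists_measurable_superset_iInter_eq_empty {X ι : Type*} [TopologicalSpace X]
    [PolishSpace X] [MeasurableSpace X] [BorelSpace X] [Fintype ι] {M : ι → Set X}
    (hM : ∀ i, AnalyticSet (M i)) (h : ⋂ i, M i = ∅) :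
    ∃ B : ι → Set X, (∀ i, MeasurableSet (B i)) ∧ (∀ i, M i ⊆ B i) ∧ ⋂ i, B i = ∅ := by
  classical
  -- The auxiliary `A` carries the sets not yet enlarged. Once those indexed by `s` are enlarged
  -- against `A ∩ M i`, Lusin separation of two analytic sets enlarges `M i`.
  have key : ∀ (s : Finset ι) (A : Set X), AnalyticSet A → A ∩ ⋂ i ∈ s, M i = ∅ →
      ∃ B : ι → Set X, (∀ i, MeasurableSet (B i)) ∧ (∀ i, M i ⊆ B i) ∧
        A ∩ ⋂ i ∈ s, B i = ∅ := by
    intro s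
    induction s using Finset.induction_on with
    | empty =>
      intro A _ h
      exact ⟨fun _ => univ, fun _ => MeasurableSet.univ, fun _ => subset_univ _, by simpa using h⟩
    | insert i s hi ih =>
      intro A hA h
      have hinter : ∀ {U V : Set X}, AnalyticSet U → AnalyticSet V → AnalyticSet (U ∩ V) := by
        intro U V hU hV
        rw [inter_eq_iInter]
        exact AnalyticSet.iInter fun b => by cases b <;> assumption
      obtain ⟨B, hB, hMB, he⟩ := ih (A ∩ M i) (hinter hA (hM i)) (by
        rw [← h, Finset.set_biInter_insert, inter_assoc])
      have hBs : MeasurableSet (⋂ j ∈ s, B j) := s.measurableSet_biInter fun j _ => hB j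
      have hd : Disjoint (M i) (A ∩ ⋂ j ∈ s, B j) := by
        rw [disjoint_iff_inter_eq_empty, ← he]
        ext x
        simp only [mem_inter_iff]
        tauto
      obtain ⟨u, hMu, hdu, hu⟩ := (hM i).measurablySeparable (hinter hA hBs.analyticSet) hd
      refine ⟨Function.update B i u, fun j => ?_, fun j => ?_, ?_⟩
      · by_cases hj : j = i
        · subst hj; simpa using hu
        · simpa [hj] using hB j
      · by_cases hj : j = i
        · subst hj; simpa using hMu
        · simpa [hj] using hMB j
      · rw [Finset.set_biInter_insert]
        have : ⋂ j ∈ s, Function.update B i u j = ⋂ j ∈ s, B j := by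
          refine iInter₂_congr fun j hj => ?_
          rw [Function.update_of_ne]
          rintro rfl
          exact hi hj
        rw [this, Function.update_self]
        rw [disjoint_iff_inter_eq_empty] at hdu
        rw [← hdu]
        ext x
        simp only [mem_inter_iff]
        tauto
  obtain ⟨B, hB, hMB, he⟩ := key Finset.univ univ MeasurableSet.univ.analyticSet (by simpa using h)
  exact ⟨B, hB, hMB, by simpa using he⟩

/-- The base `X` splits into Borel pieces, one for each member of the family `U`, such that over
its piece each `U i` is a countable union of sets on which `f` is injective. -/
def SplitsSigmaInj {Z X ι : Type*} [MeasurableSpace Z] [MeasurableSpace X] (f : Z → X)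
    (U : ι → Set Z) : Prop :=
  ∃ B : ι → Set X, (∀ i, MeasurableSet (B i)) ∧ (⋃ i, B i = univ) ∧
    ∀ i, IsSigmaInjOn f (U i ∩ f ⁻¹' B i)

theorem SplitsSigmaInj.of_equiv {Z X ι κ : Type*} [MeasurableSpace Z] [MeasurableSpace X]
    {f : Z → X} {U : ι → Set Z} (e : κ ≃ ι) (h : SplitsSigmaInj f (fun k => U (e k))) :
    SplitsSigmaInj f U := by
  obtain ⟨B, hB, hU, hI⟩ := h
  refine ⟨fun i => B (e.symm i), fun i => hB _, ?_, fun i => ?_⟩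
  · rw [← hU]
    exact e.symm.surjective.iUnion_comp B
  · simpa using hI (e.symm i)

variable {Z X : Type*} [MetricSpace Z] [CompleteSpace Z] [SecondCountableTopology Z]
  [MeasurableSpace Z] [BorelSpace Z] [TopologicalSpace X] [PolishSpace X] [MeasurableSpace X]
  [BorelSpace X] {f : Z → X}

/-- If over every point of `X` some `U i` has at most one point, then `U` splits. -/
theorem SplitsSigmaInj.of_forall_exists_subsingleton {ι : Type*} [Fintype ι] (hf : Continuous f)
    {U : ι → Set Z} (hU : ∀ i, MeasurableSet (U i))
    (h : ∀ x, ∃ i, (U i ∩ f ⁻¹' {x}).Subsingleton) : SplitsSigmaInj f U := by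
  -- `M i` is the analytic set of points with at least two preimages in `U i`; outside any superset
  -- of it, `f` is injective on `U i`.
  set M : ι → Set X := fun i =>
    (fun p : Z × Z => f p.1) '' {p | p.1 ∈ U i ∧ p.2 ∈ U i ∧ p.1 ≠ p.2 ∧ f p.1 = f p.2} with hM
  have hMa : ∀ i, AnalyticSet (M i) := by
    intro i
    refine MeasurableSet.analyticSet_image ?_ (hf.comp continuous_fst).measurable
    have h3 : MeasurableSet {p : Z × Z | p.1 ≠ p.2} :=
      (measurableSet_eq_fun measurable_fst measurable_snd).compl
    have h4 : MeasurableSet {p : Z × Z | f p.1 = f p.2} :=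
      measurableSet_eq_fun (hf.measurable.comp measurable_fst) (hf.measurable.comp measurable_snd)
    exact (measurable_fst (hU i)).inter ((measurable_snd (hU i)).inter (h3.inter h4))
  obtain ⟨B, hB, hMB, he⟩ := exists_measurable_superset_iInter_eq_empty hMa (by
    refine eq_empty_of_forall_notMem fun x hx => ?_
    obtain ⟨i, hi⟩ := h x
    obtain ⟨⟨z, w⟩, ⟨hz, hw, hne, hzw⟩, rfl⟩ := mem_iInter.1 hx i
    exact hne (hi ⟨hz, rfl⟩ ⟨hw, hzw.symm⟩))
  refine ⟨fun i => (B i)ᶜ, fun i => (hB i).compl, ?_, fun i => ?_⟩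
  · rw [← compl_iInter, he, compl_empty]
  · refine IsSigmaInjOn.of_injOn ((hU i).inter (hf.measurable (hB i).compl)) ?_
    intro z hz w hw hzw
    by_contra hne
    exact hz.2 (hMB i ⟨(z, w), ⟨hz.1, hw.1, hne, hzw⟩, rfl⟩)

/-- A family that does not split can be refined to one with two small disjoint open sets inside each
member. -/
theorem exists_refinement_not_splits {ι : Type*} [Fintype ι] (hf : Continuous f)
    {U : ι → Set Z} (hU : ∀ i, IsOpen (U i)) (h : ¬ SplitsSigmaInj f U) {δ : ℝ} (hδ : 0 < δ) :
    ∃ V : ι → Bool → Set Z, (∀ i b, IsOpen (V i b) ∧ closure (V i b) ⊆ U i ∧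
      ∃ c, V i b ⊆ Metric.ball c δ) ∧ (∀ i, Disjoint (V i false) (V i true)) ∧
      ¬ SplitsSigmaInj f (fun p : ι × Bool => V p.1 p.2) := by
  by_contra! hcon
  apply h
  -- Members of a countable basis suffice, so there are only countably many refinements. If all of
  -- them split, the union `N` of their pieces is still covered by countably many injective sets.
  let T := {V : ι → Bool → TopologicalSpace.countableBasis Z //
    (∀ i b, closure (V i b : Set Z) ⊆ U i ∧ ∃ c, (V i b : Set Z) ⊆ Metric.ball c δ) ∧
      ∀ i, Disjoint (V i false : Set Z) (V i true : Set Z)}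
  have hTo : ∀ (V : T) i b, IsOpen (V.1 i b : Set Z) := fun V i b =>
    TopologicalSpace.isOpen_of_mem_countableBasis (V.1 i b).2
  have hT : ∀ V : T, SplitsSigmaInj f (fun p : ι × Bool => (V.1 p.1 p.2 : Set Z)) := fun V =>
    hcon (fun i b => V.1 i b) (fun i b => ⟨hTo V i b, V.2.1 i b⟩) V.2.2
  choose B hB hBU hBI using hT
  have : Countable (TopologicalSpace.countableBasis Z) :=
    (TopologicalSpace.countable_countableBasis Z).to_subtype
  set N : Set Z := ⋃ (V : T) (p : ι × Bool), (V.1 p.1 p.2 : Set Z) ∩ f ⁻¹' B V p with hN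
  have hNm : MeasurableSet N := MeasurableSet.iUnion fun V => MeasurableSet.iUnion fun p =>
    (hTo V p.1 p.2).measurableSet.inter (hf.measurable (hB V p))
  have hNI : IsSigmaInjOn f N :=
    IsSigmaInjOn.iUnion fun V => IsSigmaInjOn.iUnion fun p => hBI V p
  have hsplit : SplitsSigmaInj f (fun i => U i \ N) := by
    refine SplitsSigmaInj.of_forall_exists_subsingleton hf
      (fun i => (hU i).measurableSet.diff hNm) fun x => ?_
    -- Two points of each `U i \ N` over `x` have small disjoint basic neighbourhoods, which form a
    -- refinement in `T`. One of its Borel pieces contains `x`, and this puts one of the chosen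
    -- points in `N`.
    by_contra! hx
    choose z hz w hw hne using hx
    have hpt : ∀ i (a b : Z), a ∈ U i → a ≠ b → ∃ V ∈ TopologicalSpace.countableBasis Z,
        a ∈ V ∧ closure V ⊆ U i ∧ V ⊆ Metric.ball a δ ∧ V ⊆ Metric.ball a (dist a b / 2) := by
      intro i a b ha hab
      have hr : 0 < min δ (dist a b / 2) := lt_min hδ (half_pos (dist_pos.2 hab))
      have hO : U i ∩ Metric.ball a (min δ (dist a b / 2)) ∈ 𝓝 a :=
        Filter.inter_mem ((hU i).mem_nhds ha) (Metric.ball_mem_nhds a hr)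
      obtain ⟨K, ⟨hK, hKc⟩, hKO⟩ := (closed_nhds_basis a).mem_iff.1 hO
      obtain ⟨V, hV, haV, hVK⟩ :=
        (TopologicalSpace.isBasis_countableBasis Z).mem_nhds_iff.1 hK
      refine ⟨V, hV, haV, (closure_minimal hVK hKc).trans (hKO.trans inter_subset_left), ?_, ?_⟩
      · exact (hVK.trans (hKO.trans inter_subset_right)).trans
          (Metric.ball_subset_ball (min_le_left _ _))
      · exact (hVK.trans (hKO.trans inter_subset_right)).trans
          (Metric.ball_subset_ball (min_le_right _ _))
    choose V₀ hV₀ hz₀ hc₀ hδ₀ hd₀ using fun i => hpt i (z i) (w i) (hz i).1.1 (hne i)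
    choose V₁ hV₁ hz₁ hc₁ hδ₁ hd₁ using fun i => hpt i (w i) (z i) (hw i).1.1 (hne i).symm
    let V : T := ⟨fun i b => if b then ⟨V₁ i, hV₁ i⟩ else ⟨V₀ i, hV₀ i⟩, by
      refine ⟨fun i b => ?_, fun i => ?_⟩
      · cases b
        · exact ⟨hc₀ i, _, hδ₀ i⟩
        · exact ⟨hc₁ i, _, hδ₁ i⟩
      · refine Disjoint.mono (hd₀ i) (hd₁ i) (Metric.ball_disjoint_ball ?_)
        rw [dist_comm (w i)]
        linarith⟩
    obtain ⟨⟨i, b⟩, hi⟩ := mem_iUnion.1 ((hBU V).symm ▸ mem_univ x)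
    cases b
    · refine (hz i).1.2 (mem_iUnion.2 ⟨V, mem_iUnion.2 ⟨(i, false), hz₀ i, ?_⟩⟩)
      rw [mem_preimage, (hz i).2]
      exact hi
    · refine (hw i).1.2 (mem_iUnion.2 ⟨V, mem_iUnion.2 ⟨(i, true), hz₁ i, ?_⟩⟩)
      rw [mem_preimage, (hw i).2]
      exact hi
  obtain ⟨B', hB', hU', hI'⟩ := hsplit
  refine ⟨B', hB', hU', fun i => ((hI' i).union hNI).mono ?_⟩
  rintro z ⟨hz, hzB⟩
  by_cases hzN : z ∈ N
  · exact Or.inr hzN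
  · exact Or.inl ⟨⟨hz, hzN⟩, hzB⟩

/-- A continuous countable-to-one map on a Polish space is injective on the pieces of some countable
Borel cover. -/
theorem isSigmaInjOn_univ_of_continuous (hf : Continuous f)
    (hc : ∀ x, (f ⁻¹' {x}).Countable) : IsSigmaInjOn f univ := by
  by_contra hI
  let S : ℕ → Type _ := fun n => {U : (Fin n → Bool) → Set Z //
    (∀ i, IsOpen (U i)) ∧ ¬ SplitsSigmaInj f U}
  have step : ∀ n (U : S n), ∃ U' : S (n + 1),
      (∀ t : Fin (n + 1) → Bool, closure (U'.1 t) ⊆ U.1 (Fin.init t) ∧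
        ∃ c, U'.1 t ⊆ Metric.ball c ((1 / 2 : ℝ) ^ n)) ∧
      ∀ t t' : Fin (n + 1) → Bool, Fin.init t = Fin.init t' → t (Fin.last n) ≠ t' (Fin.last n) →
        Disjoint (U'.1 t) (U'.1 t') := by
    rintro n ⟨U, hU, hUI⟩
    obtain ⟨V, hV, hVd, hVI⟩ :=
      exists_refinement_not_splits hf hU hUI (δ := (1 / 2 : ℝ) ^ n) (by positivity)
    let e : (Fin (n + 1) → Bool) ≃ (Fin n → Bool) × Bool :=
      { toFun := fun t => (Fin.init t, t (Fin.last n))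
        invFun := fun p => Fin.snoc p.1 p.2
        left_inv := fun t => Fin.snoc_init_self t
        right_inv := fun p => by ext <;> simp }
    refine ⟨⟨fun t => V (Fin.init t) (t (Fin.last n)), fun t => (hV _ _).1, fun h => hVI ?_⟩,
      fun t => (hV _ _).2, ?_⟩
    · exact SplitsSigmaInj.of_equiv e h
    · intro t t' h h'
      simp only [h]
      rcases ht : t (Fin.last n) with _ | _ <;> rcases ht' : t' (Fin.last n) with _ | _
      · exact absurd (ht.trans ht'.symm) h'
      · exact hVd _
      · exact (hVd _).symm
      · exact absurd (ht.trans ht'.symm) h'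
  choose next hnext hdisj using step
  -- Level 0 has a single index, so a splitting there would be a countable injective cover of the
  -- whole space.
  let U₀ : S 0 := ⟨fun _ => univ, fun _ => isOpen_univ, fun ⟨B, _, hBU, hBI⟩ => hI <|
    (IsSigmaInjOn.iUnion hBI).mono fun z _ => by
      obtain ⟨i, hi⟩ := mem_iUnion.1 (hBU.symm ▸ mem_univ (f z))
      exact mem_iUnion.2 ⟨i, mem_univ z, hi⟩⟩
  let W : ∀ n, S n := fun n => Nat.rec U₀ next n
  -- Empty sets are subsingletons: if over every point some member were empty, the family would
  -- split.
  have hcommon : ∀ n, ∃ x, ∀ i, ((W n).1 i ∩ f ⁻¹' {x}).Nonempty := by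
    intro n
    by_contra! hx
    exact (W n).2.2 (SplitsSigmaInj.of_forall_exists_subsingleton hf
      (fun i => ((W n).2.1 i).measurableSet) fun x => by
        obtain ⟨i, hi⟩ := hx x
        exact ⟨i, by simp [hi]⟩)
  choose x hx using hcommon
  choose z hz using hx
  let r : (ℕ → Bool) → ∀ n, Fin n → Bool := fun α n i => α i
  have hanti : ∀ α n, (W (n + 1)).1 (r α (n + 1)) ⊆ (W n).1 (r α n) := fun α n =>
    subset_closure.trans (hnext n (W n) (r α (n + 1))).1
  have hanti' : ∀ α, Antitone fun n => (W n).1 (r α n) := fun α => antitone_nat_of_succ_le (hanti α)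
  have hball : ∀ α n, ∃ c, (W (n + 1)).1 (r α (n + 1)) ⊆ Metric.ball c ((1 / 2 : ℝ) ^ n) :=
    fun α n => (hnext n (W n) (r α (n + 1))).2
  have hcauchy : ∀ α, CauchySeq fun n => z n (r α n) := by
    intro α
    rw [Metric.cauchySeq_iff]
    intro ε hε
    obtain ⟨n, hn⟩ := exists_pow_lt_of_lt_one (half_pos hε) (by norm_num : (1 / 2 : ℝ) < 1)
    obtain ⟨c, hc⟩ := hball α n
    refine ⟨n + 1, fun m hm k hk => ?_⟩
    have h1 := hc (hanti' α hm (hz m (r α m)).1)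
    have h2 := hc (hanti' α hk (hz k (r α k)).1)
    rw [Metric.mem_ball] at h1 h2
    calc dist (z m (r α m)) (z k (r α k)) ≤ _ := dist_triangle_right _ _ c
      _ < ε := by linarith
  choose g hg using fun α => cauchySeq_tendsto_of_complete (hcauchy α)
  -- The points `x n` do not depend on the branch, so all limits `g α` lie in one fibre.
  have hfg : ∀ α, Filter.Tendsto x Filter.atTop (𝓝 (f (g α))) := by
    intro α
    have := (hf.tendsto (g α)).comp (hg α)
    refine this.congr fun n => ?_
    exact (hz n (r α n)).2
  have hgmem : ∀ α n, g α ∈ (W n).1 (r α n) := by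
    intro α n
    refine (hnext n (W n) (r α (n + 1))).1 (mem_closure_of_tendsto (hg α) ?_)
    filter_upwards [Filter.eventually_ge_atTop (n + 1)] with m hm
    exact hanti' α hm (hz m (r α m)).1
  have hginj : Function.Injective g := by
    intro α β hαβ
    have hr : ∀ n, r α n = r β n := by
      intro n
      induction n with
      | zero => exact Subsingleton.elim _ _
      | succ n ih =>
        by_contra hne
        refine Set.disjoint_left.1 (hdisj n (W n) (r α (n + 1)) (r β (n + 1)) ih ?_)
          (hgmem α (n + 1)) (hαβ ▸ hgmem β (n + 1))
        intro hlast
        apply hne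
        rw [← Fin.snoc_init_self (r α (n + 1)), ← Fin.snoc_init_self (r β (n + 1)), hlast]
        exact congrArg (fun t => Fin.snoc (α := fun _ => Bool) t _) ih
    funext n
    exact congrFun (hr (n + 1)) (Fin.last n)
  have hcount : (f ⁻¹' {f (g fun _ => false)}).Countable := hc _
  have : (univ : Set (ℕ → Bool)).Countable := by
    refine (hcount.preimage_of_injOn (hginj.injOn)).mono fun α _ => ?_
    exact tendsto_nhds_unique (hfg α) (hfg _)
  have hle := Cardinal.mk_le_aleph0_iff.2 (countable_univ_iff.1 this)
  simp at hle
  exact absurd hle (not_le.2 Cardinal.aleph0_lt_continuum)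

end LusinNovikov

end BorelTrees

namespace BorelTrees

/-! ### Borel images, transversals and uniformization for countable-to-one maps. -/

section CountableToOne

variable {Z X : Type*} [MeasurableSpace Z] [StandardBorelSpace Z] [MeasurableSpace X]
  [StandardBorelSpace X] {f : Z → X} {B : Set Z}

/-- A finer Polish topology with the same Borel sets makes `f` continuous. -/
theorem isSigmaInjOn_univ (hf : Measurable f) (hc : ∀ x, (f ⁻¹' {x}).Countable) :
    IsSigmaInjOn f univ := by
  let := upgradeStandardBorel X
  let tZ := upgradeStandardBorel Z
  obtain ⟨τ, hτ, hfτ, hP⟩ := hf.exists_continuous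
  have hB : @BorelSpace Z τ _ := by
    refine @BorelSpace.mk Z τ _ ?_
    rw [@borel_eq_borel_of_le Z τ tZ.toTopologicalSpace hP inferInstance hτ]
    exact BorelSpace.measurable_eq
  let := τ
  let := TopologicalSpace.upgradeIsCompletelyMetrizable Z
  exact isSigmaInjOn_univ_of_continuous hfτ hc

/-- **Lusin–Novikov**: a Borel set on which `f` is countable-to-one is a countable union of Borel
sets on which `f` is injective. -/
theorem exists_iUnion_injOn_of_countable_fibres (hf : Measurable f) (hB : MeasurableSet B)
    (hc : ∀ x, (B ∩ f ⁻¹' {x}).Countable) :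
    ∃ C : ℕ → Set Z, (∀ n, MeasurableSet (C n)) ∧ (∀ n, InjOn f (C n)) ∧ ⋃ n, C n = B := by
  have : StandardBorelSpace B := hB.standardBorel
  obtain ⟨C, hC, hCm, hCu⟩ := isSigmaInjOn_univ (f := fun b : B => f b)
    (hf.comp measurable_subtype_coe) fun x => by
      refine ((hc x).preimage Subtype.val_injective).mono fun b hb => ?_
      exact ⟨b.2, hb⟩
  -- Adding the empty set makes the family nonempty, hence the range of a sequence.
  have hC' : (insert ∅ C).Countable := hC.insert _
  obtain ⟨c, hc⟩ := hC'.exists_eq_range (insert_nonempty _ _)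
  have hcm : ∀ n, MeasurableSet (c n) ∧ InjOn (fun b : B => f b) (c n) := by
    intro n
    have : c n ∈ insert ∅ C := hc ▸ mem_range_self n
    rcases this with h | h
    · simp [h]
    · exact hCm _ h
  refine ⟨fun n => Subtype.val '' c n, fun n => hB.subtype_image (hcm n).1, fun n => ?_, ?_⟩
  · rintro _ ⟨a, ha, rfl⟩ _ ⟨b, hb, rfl⟩ hab
    rw [(hcm n).2 ha hb hab]
  · refine Subset.antisymm (iUnion_subset fun n => ?_) fun z hz => ?_
    · rintro _ ⟨a, -, rfl⟩
      exact a.2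
    · obtain ⟨s, hs, hzs⟩ := hCu (mem_univ (⟨z, hz⟩ : B))
      have : s ∈ range c := hc ▸ mem_insert_of_mem _ hs
      obtain ⟨n, rfl⟩ := this
      exact mem_iUnion.2 ⟨n, _, hzs, rfl⟩

/-- Lusin–Souslin applies to each injective piece. -/
theorem measurableSet_image_of_countable_fibres (hf : Measurable f) (hB : MeasurableSet B)
    (hc : ∀ x, (B ∩ f ⁻¹' {x}).Countable) : MeasurableSet (f '' B) := by
  obtain ⟨C, hC, hi, rfl⟩ := exists_iUnion_injOn_of_countable_fibres hf hB hc
  rw [image_iUnion]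
  exact MeasurableSet.iUnion fun n => (hC n).image_of_measurable_injOn hf (hi n)

/-- A countable-to-one Borel map has a Borel transversal. -/
theorem exists_transversal_of_countable_fibres (hf : Measurable f) (hB : MeasurableSet B)
    (hc : ∀ x, (B ∩ f ⁻¹' {x}).Countable) :
    ∃ T ⊆ B, MeasurableSet T ∧ InjOn f T ∧ f '' T = f '' B := by
  obtain ⟨C, hC, hi, rfl⟩ := exists_iUnion_injOn_of_countable_fibres hf hB hc
  have himg : ∀ n, MeasurableSet (f '' C n) := fun n =>
    (hC n).image_of_measurable_injOn hf (hi n)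
  -- Over each point only the first piece reaching it is kept.
  refine ⟨⋃ n, C n \ f ⁻¹' (⋃ m < n, f '' C m), ?_, ?_, ?_, ?_⟩
  · exact iUnion_mono fun n => sdiff_subset
  · exact MeasurableSet.iUnion fun n => (hC n).diff (hf (MeasurableSet.iUnion fun m =>
      MeasurableSet.iUnion fun _ => himg m))
  · intro z hz w hw hzw
    obtain ⟨n, hzn, hn⟩ := mem_iUnion.1 hz
    obtain ⟨m, hwm, hm⟩ := mem_iUnion.1 hw
    simp only [mem_preimage, mem_iUnion, not_exists] at hn hm
    rcases lt_trichotomy n m with h | rfl | h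
    · exact absurd ⟨z, hzn, hzw⟩ (hm n h)
    · exact hi n hzn hwm hzw
    · exact absurd ⟨w, hwm, hzw.symm⟩ (hn m h)
  · refine Subset.antisymm (image_mono (iUnion_mono fun n => sdiff_subset)) ?_
    rintro _ ⟨z, hz, rfl⟩
    classical
    have hex : ∃ n, f z ∈ f '' C n := by
      obtain ⟨n, hn⟩ := mem_iUnion.1 hz
      exact ⟨n, z, hn, rfl⟩
    obtain ⟨w, hw, hwz⟩ := Nat.find_spec hex
    refine ⟨w, mem_iUnion.2 ⟨Nat.find hex, hw, ?_⟩, hwz⟩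
    simp only [mem_preimage, mem_iUnion, not_exists]
    intro m hm h
    exact Nat.find_min hex hm (hwz ▸ h)

/-- A preimage is the projection of a Borel part of the graph, and this projection is injective. -/
theorem measurable_of_measurableSet_graph {g : X → Z}
    (hg : MeasurableSet {p : X × Z | p.2 = g p.1}) : Measurable g := by
  intro A hA
  have : g ⁻¹' A = Prod.fst '' ({p : X × Z | p.2 = g p.1} ∩ Prod.snd ⁻¹' A) := by
    ext x
    simp
  rw [this]
  refine (hg.inter (measurable_snd hA)).image_of_measurable_injOn measurable_fst ?_
  rintro ⟨x, z⟩ ⟨h, -⟩ ⟨x', z'⟩ ⟨h', -⟩ hx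
  simp_all

/-- **Lusin–Novikov uniformization** of a Borel set with countable nonempty sections. -/
theorem exists_measurable_uniformization {P : Set (X × Z)} (hP : MeasurableSet P)
    (hc : ∀ x, {z | (x, z) ∈ P}.Countable) (hne : ∀ x, ∃ z, (x, z) ∈ P) :
    ∃ g : X → Z, Measurable g ∧ ∀ x, (x, g x) ∈ P := by
  obtain ⟨T, hTP, hT, hi, himg⟩ := exists_transversal_of_countable_fibres (f := Prod.fst)
    measurable_fst hP fun x => by
      refine ((hc x).image (Prod.mk x)).mono ?_
      rintro ⟨x', z⟩ ⟨h, rfl⟩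
      exact ⟨z, h, rfl⟩
  have hex : ∀ x, ∃ z, (x, z) ∈ T := by
    intro x
    obtain ⟨z, hz⟩ := hne x
    obtain ⟨⟨x', w⟩, hw, rfl⟩ : x ∈ Prod.fst '' T := himg ▸ ⟨(x, z), hz, rfl⟩
    exact ⟨w, hw⟩
  choose g hg using hex
  refine ⟨g, measurable_of_measurableSet_graph ?_, fun x => hTP (hg x)⟩
  convert hT
  ext ⟨x, z⟩
  refine ⟨fun h => ?_, fun h => ?_⟩
  · rw [mem_ofPred_eq] at h
    simp only at h
    exact h ▸ hg x
  · exact congrArg Prod.snd (hi h (hg x) rfl)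

end CountableToOne

/-! ### Permanence properties of smooth relations. -/

section Smooth

variable {Y : Type u} [MeasurableSpace Y] [StandardBorelSpace Y] {S : Setoid Y}

/-- The saturation of a Borel set is Borel. -/
theorem IsCountableBorel.measurableSet_saturation (hS : IsCountableBorel S) {Q : Set Y}
    (hQ : MeasurableSet Q) : MeasurableSet {y | ∃ q ∈ Q, S q y} := by
  have : {y | ∃ q ∈ Q, S q y} = Prod.snd '' ({p : Y × Y | S p.1 p.2} ∩ Prod.fst ⁻¹' Q) := by
    ext y
    simp only [mem_ofPred_eq, mem_image, mem_inter_iff, mem_preimage, Prod.exists]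
    constructor
    · rintro ⟨q, hq, h⟩
      exact ⟨q, y, ⟨h, hq⟩, rfl⟩
    · rintro ⟨q, y, ⟨h, hq⟩, rfl⟩
      exact ⟨q, hq, h⟩
  rw [this]
  refine measurableSet_image_of_countable_fibres measurable_snd
    (hS.measurableSet.inter (measurable_fst hQ)) fun y => ?_
  refine ((hS.countable y).image fun q => (q, y)).mono ?_
  rintro ⟨q, y'⟩ ⟨⟨h, -⟩, rfl⟩
  exact ⟨q, S.symm h, rfl⟩

/-- Smoothness pulls back along countable-to-one Borel maps. -/
theorem IsSmooth.comap {A : Type u} [MeasurableSpace A] [StandardBorelSpace A]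
    (hS : IsCountableBorel S) (h : IsSmooth S) {g : A → Y} (hg : Measurable g)
    (hc : ∀ y, (g ⁻¹' {y}).Countable) : IsSmooth (S.comap g) := by
  obtain ⟨D, hD, hDu⟩ := h
  -- `W` is the graph of the map from `a` to the representative of `g a` in `D`. A transversal of
  -- its second projection picks one `a` for each representative attained.
  set W : Set (A × Y) := {p | S (g p.1) p.2 ∧ p.2 ∈ D} with hW
  have hWm : MeasurableSet W :=
    (((hg.comp measurable_fst).prodMk measurable_snd) hS.measurableSet).inter (measurable_snd hD)
  have huniq : ∀ {a d d'}, (a, d) ∈ W → (a, d') ∈ W → d = d' := fun {a d d'} h h' =>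
    (hDu (g a)).unique ⟨h.2, h.1⟩ ⟨h'.2, h'.1⟩
  obtain ⟨T, hTW, hT, hi, himg⟩ := exists_transversal_of_countable_fibres (f := Prod.snd)
    measurable_snd hWm fun y => by
      have : (⋃ y' ∈ {y' | S y y'}, g ⁻¹' {y'}).Countable :=
        (hS.countable y).biUnion fun y' _ => hc y'
      refine (this.image fun a => (a, y)).mono ?_
      rintro ⟨a, y'⟩ ⟨⟨h, -⟩, rfl⟩
      exact ⟨a, mem_biUnion (S.symm h) rfl, rfl⟩
  refine ⟨Prod.fst '' T, hT.image_of_measurable_injOn measurable_fst ?_, fun a => ?_⟩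
  · rintro ⟨a, d⟩ h ⟨a', d'⟩ h' (rfl : a = a')
    rw [huniq (hTW h) (hTW h')]
  · obtain ⟨d, ⟨hd, had⟩, -⟩ := hDu (g a)
    obtain ⟨⟨b, d'⟩, hb, rfl⟩ : d ∈ Prod.snd '' T := himg ▸ ⟨(a, d), ⟨had, hd⟩, rfl⟩
    refine ⟨b, ⟨⟨_, hb, rfl⟩, S.trans had (S.symm (hTW hb).1)⟩, ?_⟩
    rintro c ⟨⟨⟨c', e⟩, hc', rfl⟩, hac⟩
    have he : e = d' := huniq (a := a) ⟨S.trans hac (hTW hc').1, (hTW hc').2⟩ ⟨had, hd⟩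
    exact congrArg Prod.fst (hi hc' hb he)

/-- A relation is smooth once countably many Borel partial transversals meet every class. -/
theorem IsCountableBorel.isSmooth_of_iUnion (hS : IsCountableBorel S) {D : ℕ → Set Y}
    (hD : ∀ n, MeasurableSet (D n)) (hi : ∀ n, ∀ d ∈ D n, ∀ d' ∈ D n, S d d' → d = d')
    (hcover : ∀ y, ∃ n, ∃ d ∈ D n, S y d) : IsSmooth S := by
  classical
  -- Each `D n` gives up the classes already met by an earlier `D m`.
  refine ⟨⋃ n, D n \ ⋃ m < n, {y | ∃ q ∈ D m, S q y}, ?_, fun y => ?_⟩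
  · exact MeasurableSet.iUnion fun n => (hD n).diff (MeasurableSet.iUnion fun m =>
      MeasurableSet.iUnion fun _ => hS.measurableSet_saturation (hD m))
  · have hspec := Nat.find_spec (hcover y)
    have hmin := fun m => Nat.find_min (m := m) (hcover y)
    generalize Nat.find (hcover y) = n at hspec hmin
    obtain ⟨d, hd, hyd⟩ := hspec
    refine ⟨d, ⟨mem_iUnion.2 ⟨n, hd, ?_⟩, hyd⟩, ?_⟩
    · simp only [mem_iUnion, mem_ofPred_eq, not_exists]
      rintro m hm q ⟨hq, hqd⟩
      exact hmin m hm ⟨q, hq, S.trans hyd (S.symm hqd)⟩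
    · rintro e ⟨he, hye⟩
      obtain ⟨k, hek, hk⟩ := mem_iUnion.1 he
      simp only [mem_iUnion, mem_ofPred_eq, not_exists] at hk
      rcases lt_trichotomy k n with h | rfl | h
      · exact absurd ⟨e, hek, hye⟩ (hmin k h)
      · exact hi k e hek d hd (S.trans (S.symm hye) hyd)
      · exact absurd ⟨hd, S.trans (S.symm hyd) hye⟩ (hk n h d)

end Smooth

/-! ### Quasi-free actions are the smooth ones. -/

namespace RSpace

variable {X : Type u} [MeasurableSpace X] {R : Setoid X}

theorem isCountableBorel_orbitRel (hR : IsCountableBorel R) (F : RSpace R) :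
    IsCountableBorel F.orbitRel where
  measurableSet := by
    have hQ : MeasurableSet {p : F.carrier × F.carrier | R (F.proj p.1) (F.proj p.2)} :=
      ((F.measurable_proj.comp measurable_fst).prodMk
        (F.measurable_proj.comp measurable_snd)) hR.measurableSet
    let Q := {p : F.carrier × F.carrier | R (F.proj p.1) (F.proj p.2)}
    have hact : Measurable fun q : Q =>
        F.act (F.proj q.1.1) (F.proj q.1.2) q.1.2 q.2 rfl := by
      have hι : Measurable fun q : Q => (⟨((F.proj q.1.1, F.proj q.1.2), q.1.2), q.2, rfl⟩ :
          {q : (X × X) × F.carrier // R q.1.1 q.1.2 ∧ F.proj q.2 = q.1.2}) := by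
        refine Measurable.subtype_mk ?_
        refine Measurable.prodMk (Measurable.prodMk ?_ ?_) ?_
        · exact F.measurable_proj.comp (measurable_fst.comp measurable_subtype_coe)
        · exact F.measurable_proj.comp (measurable_snd.comp measurable_subtype_coe)
        · exact measurable_snd.comp measurable_subtype_coe
      exact F.measurable_act.comp hι
    have hE : MeasurableSet {q : Q | F.act (F.proj q.1.1) (F.proj q.1.2) q.1.2 q.2 rfl = q.1.1} :=
      measurableSet_eq_fun hact (measurable_fst.comp measurable_subtype_coe)
    convert hQ.subtype_image hE
    ext ⟨a, b⟩
    constructor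
    · rintro ⟨h, e⟩
      exact ⟨⟨(a, b), h⟩, e, rfl⟩
    · rintro ⟨⟨p, h⟩, e, rfl⟩
      exact ⟨h, e⟩
  countable := by
    intro f
    have : (⋃ y ∈ {y | R (F.proj f) y}, F.proj ⁻¹' {y}).Countable :=
      (hR.countable _).biUnion fun y _ => F.countable_fibre y
    refine this.mono ?_
    rintro g ⟨h, -⟩
    exact mem_biUnion h rfl

variable [StandardBorelSpace X]

/-- A partial section is injective, since `proj` inverts it, so smoothness pulls back along it. -/
theorem IsSmoothAction.isQuasiFree (hR : IsCountableBorel R) {F : RSpace R}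
    (h : F.IsSmoothAction) : F.IsQuasiFree := by
  intro A s hs
  have : StandardBorelSpace A := hs.measurableSet_domain.standardBorel
  refine IsSmooth.comap (F.isCountableBorel_orbitRel hR) h hs.measurable fun y => ?_
  refine Set.Subsingleton.countable fun a ha b hb => Subtype.ext ?_
  rw [← hs.proj_eq a, ← hs.proj_eq b, ha, hb]

/-- By Lusin–Novikov, `F` is a countable union of images of partial sections. A fundamental domain
of each stabilizer maps to a Borel partial transversal of the orbits, and these are glued. -/
theorem IsQuasiFree.isSmoothAction (hR : IsCountableBorel R) {F : RSpace R}
    (h : F.IsQuasiFree) : F.IsSmoothAction := by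
  obtain ⟨C, hC, hi, hU⟩ := exists_iUnion_injOn_of_countable_fibres F.measurable_proj
    MeasurableSet.univ fun x => by simpa using F.countable_fibre x
  have hD : ∀ n, ∃ D : Set F.carrier, MeasurableSet D ∧
      (∀ d ∈ D, ∀ d' ∈ D, F.orbitRel d d' → d = d') ∧ ∀ y ∈ C n, ∃ d ∈ D, F.orbitRel y d := by
    intro n
    have hA : MeasurableSet (F.proj '' C n) :=
      (hC n).image_of_measurable_injOn F.measurable_proj (hi n)
    have : StandardBorelSpace (F.proj '' C n : Set X) := hA.standardBorel
    choose s hsC hs using fun a : (F.proj '' C n : Set X) => a.2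
    have hsm : Measurable s := by
      refine measurable_of_measurableSet_graph ?_
      have : MeasurableSet {p : (F.proj '' C n : Set X) × F.carrier |
          p.2 ∈ C n ∧ F.proj p.2 = p.1} :=
        (measurable_snd (hC n)).inter (measurableSet_eq_fun (F.measurable_proj.comp measurable_snd)
          (measurable_subtype_coe.comp measurable_fst))
      refine (congrArg MeasurableSet (Set.ext ?_)).mpr this
      rintro ⟨a, t⟩
      constructor
      · rintro (rfl : t = s a)
        exact ⟨hsC a, hs a⟩
      · rintro ⟨ht, hta⟩
        exact hi n ht (hsC a) (hta.trans (hs a).symm)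
    have hsi : Function.Injective s := fun a b hab => Subtype.ext (by rw [← hs a, ← hs b, hab])
    obtain ⟨E, hE, hEu⟩ := h _ s ⟨hA, hsm, hs⟩
    refine ⟨s '' E, hE.image_of_measurable_injOn hsm hsi.injOn, ?_, ?_⟩
    · rintro _ ⟨a, ha, rfl⟩ _ ⟨b, hb, rfl⟩ hab
      rw [(hEu a).unique ⟨ha, F.orbitRel.refl (s a)⟩ ⟨hb, hab⟩]
    · intro y hy
      obtain ⟨d, ⟨hd, hyd⟩, -⟩ := hEu ⟨F.proj y, y, hy, rfl⟩
      refine ⟨s d, ⟨d, hd, rfl⟩, ?_⟩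
      have : s ⟨F.proj y, y, hy, rfl⟩ = y := hi n (hsC _) hy (hs _)
      have hyd' : F.orbitRel (s ⟨F.proj y, y, hy, rfl⟩) (s d) := hyd
      rwa [this] at hyd'
  choose D hDm hDi hDc using hD
  refine (F.isCountableBorel_orbitRel hR).isSmooth_of_iUnion hDm hDi fun y => ?_
  obtain ⟨n, hn⟩ := mem_iUnion.1 (hU.symm ▸ mem_univ y)
  exact ⟨n, hDc n y hn⟩

theorem isQuasiFree_iff_isSmoothAction (hR : IsCountableBorel R) (F : RSpace R) :
    F.IsQuasiFree ↔ F.IsSmoothAction :=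
  ⟨IsQuasiFree.isSmoothAction hR, IsSmoothAction.isQuasiFree hR⟩

end RSpace

end BorelTrees

namespace BorelTrees

/-! ### From a treeing to an arboretum. -/

section Treeing

variable {X : Type u} [MeasurableSpace X] [StandardBorelSpace X] {R : Setoid X}

/-- The relation `R` as an `R`-space over its first coordinate: the action changes the first
coordinate only. -/
def leftSpace (hR : IsCountableBorel R) : RSpace R where
  carrier := {p : X × X // R p.1 p.2}
  standardBorel := hR.measurableSet.standardBorel
  proj p := p.1.1
  measurable_proj := measurable_fst.comp measurable_subtype_coe
  countable_fibre x := by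
    refine (((hR.countable x).image (Prod.mk x)).preimage Subtype.val_injective).mono ?_
    rintro ⟨⟨x', y⟩, h⟩ rfl
    exact ⟨y, h, rfl⟩
  act x y t h ht := ⟨(x, t.1.2), R.trans h (ht ▸ t.2)⟩
  measurable_act := by
    refine Measurable.subtype_mk (Measurable.prodMk ?_ ?_)
    · exact (measurable_fst.comp measurable_fst).comp measurable_subtype_coe
    · exact (measurable_snd.comp measurable_subtype_coe).comp
        (measurable_snd.comp measurable_subtype_coe)
  proj_act _ _ _ _ _ := rfl
  act_self := by rintro z t rfl; rfl
  act_act _ _ _ _ _ _ _ := rfl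

/-- The edges of a treeing, copied over every point of their class. -/
def leftEdgeSpace (hR : IsCountableBorel R) {G : SimpleGraph X} (hG : IsTreeing R G) :
    RSpace R where
  carrier := {p : X × X × X // R p.1 p.2.1 ∧ G.Adj p.2.1 p.2.2}
  standardBorel := by
    refine MeasurableSet.standardBorel (MeasurableSet.inter ?_ (measurable_snd hG.measurableSet))
    exact (measurable_fst.prodMk (measurable_fst.comp measurable_snd)) hR.measurableSet
  proj p := p.1.1
  measurable_proj := measurable_fst.comp measurable_subtype_coe
  countable_fibre x := by
    have hc := (hR.countable x).prod (hR.countable x)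
    refine ((hc.image (Prod.mk x)).preimage Subtype.val_injective).mono ?_
    rintro ⟨⟨x', y, z⟩, h, h'⟩ rfl
    exact ⟨(y, z), ⟨h, R.trans h ((hG.reachable_iff _ _).1 h'.reachable)⟩, rfl⟩
  act x y t h ht := ⟨(x, t.1.2), R.trans h (ht ▸ t.2.1), t.2.2⟩
  measurable_act := by
    refine Measurable.subtype_mk (Measurable.prodMk ?_ ?_)
    · exact (measurable_fst.comp measurable_fst).comp measurable_subtype_coe
    · exact (measurable_snd.comp measurable_subtype_coe).comp
        (measurable_snd.comp measurable_subtype_coe)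
  proj_act _ _ _ _ _ := rfl
  act_self := by rintro z t rfl; rfl
  act_act _ _ _ _ _ _ _ := rfl

/-- The field of graphs whose fibre over `x` is the restriction of a treeing to the class of `x`. -/
def treeingField (hR : IsCountableBorel R) {G : SimpleGraph X} (hG : IsTreeing R G) :
    GraphField R where
  vert := leftSpace hR
  edge := leftEdgeSpace hR hG
  vert_surjective x := ⟨⟨(x, x), R.refl x⟩, rfl⟩
  origin e := ⟨(e.1.1, e.1.2.1), e.2.1⟩
  terminus e := ⟨(e.1.1, e.1.2.2), R.trans e.2.1 ((hG.reachable_iff _ _).1 e.2.2.reachable)⟩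
  rev e := ⟨(e.1.1, e.1.2.2, e.1.2.1),
    R.trans e.2.1 ((hG.reachable_iff _ _).1 e.2.2.reachable), e.2.2.symm⟩
  origin_morphism :=
    { measurable := Measurable.subtype_mk <|
        (measurable_fst.prodMk (measurable_fst.comp measurable_snd)).comp measurable_subtype_coe
      proj_eq := fun _ => rfl
      map_act := fun _ _ _ _ _ => rfl }
  terminus_morphism :=
    { measurable := Measurable.subtype_mk <|
        (measurable_fst.prodMk (measurable_snd.comp measurable_snd)).comp measurable_subtype_coe
      proj_eq := fun _ => rfl
      map_act := fun _ _ _ _ _ => rfl }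
  rev_morphism :=
    { measurable := Measurable.subtype_mk <|
        (measurable_fst.prodMk ((measurable_snd.comp measurable_snd).prodMk
          (measurable_fst.comp measurable_snd))).comp measurable_subtype_coe
      proj_eq := fun _ => rfl
      map_act := fun _ _ _ _ _ => rfl }
  rev_rev _ := rfl
  rev_ne := by
    rintro ⟨⟨x, y, z⟩, h, h'⟩ e
    exact h'.ne (congrArg (fun t => t.1.2.2) e)
  origin_rev _ := rfl

/-- Forgetting the base point embeds the fibre over `x` in `G`, so it has no cycle; walks in `G`
stay within a class, so it is connected. -/
theorem treeingField_isArboretum (hR : IsCountableBorel R) {G : SimpleGraph X}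
    (hG : IsTreeing R G) : (treeingField hR hG).IsArboretum where
  no_loop := by
    rintro ⟨⟨x, y, z⟩, h, h'⟩ e
    exact h'.ne (congrArg (fun t => t.1.2) e)
  no_multiple := by
    rintro ⟨⟨x, y, z⟩, h⟩ ⟨⟨x', y', z'⟩, h'⟩ e₁ e₂
    have h1 : x = x' := congrArg (fun t => t.1.1) e₁
    have h2 : y = y' := congrArg (fun t => t.1.2) e₁
    have h3 : z = z' := congrArg (fun t => t.1.2) e₂
    subst h1 h2 h3
    rfl
  isTree x := by
    have hadj : ∀ {a b : X} (ha : R x a) (hb : R x b), G.Adj a b →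
        ((treeingField hR hG).fibreGraph x).Adj ⟨⟨(x, a), ha⟩, rfl⟩ ⟨⟨(x, b), hb⟩, rfl⟩ := by
      intro a b ha hb hab
      refine ⟨fun e => hab.ne (congrArg (fun t => t.1.1.2) e), ⟨(x, a, b), ha, hab⟩, rfl, rfl⟩
    have hreach : ∀ {a b : X} (ha : R x a) (hb : R x b), G.Reachable a b →
        ((treeingField hR hG).fibreGraph x).Reachable
          ⟨⟨(x, a), ha⟩, rfl⟩ ⟨⟨(x, b), hb⟩, rfl⟩ := by
      rintro a b ha hb ⟨w⟩
      induction w with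
      | nil => exact SimpleGraph.Reachable.refl _
      | cons h _ ih =>
        have hc := R.trans ha ((hG.reachable_iff _ _).1 h.reachable)
        exact (hadj ha hc h).reachable.trans (ih hc hb)
    have hne : Nonempty {v : (treeingField hR hG).vert.carrier //
        (treeingField hR hG).vert.proj v = x} := ⟨⟨⟨(x, x), R.refl x⟩, rfl⟩⟩
    refine ⟨⟨?_⟩, ?_⟩
    · rintro ⟨⟨⟨x', a⟩, ha⟩, rfl⟩ ⟨⟨⟨x'', b⟩, hb⟩, hx⟩
      have hx : x'' = x' := hx
      subst hx
      exact hreach ha hb ((hG.reachable_iff a b).2 (R.trans (R.symm ha) hb))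
    · refine SimpleGraph.IsAcyclic.comap (G' := G) ⟨fun v => v.1.1.2, ?_⟩ ?_ hG.isAcyclic
      · rintro ⟨v, hv⟩ ⟨w, hw⟩ ⟨-, e, he, he'⟩
        have h1 : e.1.2.1 = v.1.2 := congrArg (fun t => t.1.2) he
        have h2 : e.1.2.2 = w.1.2 := congrArg (fun t => t.1.2) he'
        have := e.2.2
        rwa [h1, h2] at this
      · rintro ⟨⟨⟨x', a⟩, ha⟩, rfl⟩ ⟨⟨⟨x'', b⟩, hb⟩, hx⟩ hab
        have hx : x'' = x' := hx
        have hab : a = b := hab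
        subst hx hab
        rfl

/-- An orbit is determined by its second coordinate and contains exactly one diagonal pair. -/
theorem leftSpace_isSmoothAction (hR : IsCountableBorel R) : (leftSpace hR).IsSmoothAction := by
  refine ⟨{p | p.1.1 = p.1.2}, ?_, fun y => ?_⟩
  · exact measurableSet_eq_fun (measurable_fst.comp measurable_subtype_coe)
      (measurable_snd.comp measurable_subtype_coe)
  · refine ⟨⟨(y.1.2, y.1.2), R.refl _⟩, ⟨rfl, y.2, rfl⟩, ?_⟩
    rintro ⟨⟨a, b⟩, h⟩ ⟨(hab : a = b), k, e⟩
    have : b = y.1.2 := congrArg (fun t => t.1.2) e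
    subst this hab
    rfl

end Treeing

/-! ### Contracting connected pieces of a forest. -/

section Contraction

variable {Z Y : Type*}

theorem reachable_map {G : SimpleGraph Z} {H : SimpleGraph Y} {φ : Z → Y}
    (h : ∀ a b, G.Adj a b → H.Reachable (φ a) (φ b)) {a b : Z} (hab : G.Reachable a b) :
    H.Reachable (φ a) (φ b) := by
  obtain ⟨w⟩ := hab
  induction w with
  | nil => exact SimpleGraph.Reachable.refl _
  | cons hac _ ih => exact (h _ _ hac).trans ih

/-- The simple graph obtained from `G` by identifying the points of each fibre of `ρ`. -/
def contraction (G : SimpleGraph Z) (ρ : Z → Y) : SimpleGraph Y where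
  Adj x y := x ≠ y ∧ ∃ a b, G.Adj a b ∧ ρ a = x ∧ ρ b = y
  symm := ⟨fun _ _ ⟨hne, a, b, h, ha, hb⟩ => ⟨hne.symm, b, a, h.symm, hb, ha⟩⟩
  loopless := ⟨fun _ h => h.1 rfl⟩

/-- A reachability statement lifts from `H` to `G` if edges lift and fibres are connected. -/
theorem reachable_lift {G : SimpleGraph Z} {H : SimpleGraph Y} {ρ : Z → Y}
    (hρ : ∀ a b, ρ a = ρ b → G.Reachable a b)
    (h : ∀ x y, H.Adj x y → ∃ a b, G.Adj a b ∧ ρ a = x ∧ ρ b = y) {a b : Z}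
    (hab : H.Reachable (ρ a) (ρ b)) : G.Reachable a b := by
  rw [SimpleGraph.reachable_iff_reflTransGen] at hab
  generalize hy : ρ b = y at hab
  induction hab generalizing b with
  | refl => exact hρ a b hy.symm
  | tail _ hadj ih =>
    obtain ⟨c, d, hcd, hc, hd⟩ := h _ _ hadj
    exact ((ih hc).trans hcd.reachable).trans (hρ d b (hd.trans hy.symm))

theorem contraction_reachable_iff {G : SimpleGraph Z} {ρ : Z → Y}
    (hρ : ∀ a b, ρ a = ρ b → G.Reachable a b) (a b : Z) :
    (contraction G ρ).Reachable (ρ a) (ρ b) ↔ G.Reachable a b := by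
  refine ⟨reachable_lift (H := contraction G ρ) hρ fun x y h => h.2, reachable_map fun a b h => ?_⟩
  by_cases hab : ρ a = ρ b
  · rw [hab]
  · exact SimpleGraph.Adj.reachable (G := contraction G ρ) ⟨hab, a, b, h, rfl, rfl⟩

/-- Contracting connected subgraphs of a forest gives a forest. -/
theorem contraction_isAcyclic {G : SimpleGraph Z} (hG : G.IsAcyclic) {ρ : Z → Y}
    (hρ : ∀ a b, ρ a = ρ b → Relation.ReflTransGen (fun c d => G.Adj c d ∧ ρ c = ρ d) a b) :
    (contraction G ρ).IsAcyclic := by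
  rw [SimpleGraph.isAcyclic_iff_forall_adj_isBridge] at hG ⊢
  rintro x y ⟨hne, a, b, hab, rfl, rfl⟩
  rw [SimpleGraph.isBridge_iff]
  intro hreach
  -- A walk avoiding the contracted edge lifts to one avoiding `s(a, b)`: paths inside fibres never
  -- use `s(a, b)`, whose ends lie in different fibres, and every edge lifting another edge differs
  -- from it.
  refine SimpleGraph.isBridge_iff.1 (hG hab) (reachable_lift (ρ := ρ) ?_ ?_ hreach)
  · intro c d hcd
    rw [SimpleGraph.reachable_iff_reflTransGen]
    refine Relation.ReflTransGen.mono (fun c d h => ?_) _ _ (hρ c d hcd)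
    rw [SimpleGraph.deleteEdges_adj]
    refine ⟨h.1, fun he => hne ?_⟩
    rw [mem_singleton_iff, Sym2.eq_iff] at he
    rcases he with ⟨rfl, rfl⟩ | ⟨rfl, rfl⟩
    · exact h.2
    · exact h.2.symm
  · intro x y hxy
    rw [SimpleGraph.deleteEdges_adj] at hxy
    obtain ⟨⟨-, c, d, hcd, rfl, rfl⟩, hxy⟩ := hxy
    refine ⟨c, d, ?_, rfl, rfl⟩
    rw [SimpleGraph.deleteEdges_adj]
    refine ⟨hcd, fun he => hxy ?_⟩
    rw [mem_singleton_iff, Sym2.eq_iff] at he ⊢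
    rcases he with ⟨rfl, rfl⟩ | ⟨rfl, rfl⟩ <;> simp

end Contraction

/-! ### Treeability of complete sections. -/

section Restriction

variable {Z X : Type u}

/-- The points at distance at most `n` from the range of `s`. -/
def level (G : SimpleGraph Z) (s : X → Z) : ℕ → Set Z
  | 0 => range s
  | n + 1 => level G s n ∪ {z | ∃ w ∈ level G s n, G.Adj z w}

theorem level_mono (G : SimpleGraph Z) (s : X → Z) : Monotone (level G s) :=
  monotone_nat_of_le_succ fun _ => subset_union_left

variable [MeasurableSpace Z] [StandardBorelSpace Z] [MeasurableSpace X] [StandardBorelSpace X]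
  {S : Setoid Z} {s : X → Z}

theorem measurableSet_level (hS : IsCountableBorel S) {G : SimpleGraph Z} (hG : IsTreeing S G)
    (hs : Measurable s) (hi : Function.Injective s) (n : ℕ) : MeasurableSet (level G s n) := by
  induction n with
  | zero => exact (hs.measurableEmbedding hi).measurableSet_range
  | succ n ih =>
    refine ih.union ?_
    have : {z | ∃ w ∈ level G s n, G.Adj z w} =
        Prod.fst '' ({p : Z × Z | G.Adj p.1 p.2} ∩ Prod.snd ⁻¹' level G s n) := by
      ext z
      constructor
      · rintro ⟨w, hw, h⟩
        exact ⟨(z, w), ⟨h, hw⟩, rfl⟩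
      · rintro ⟨⟨z, w⟩, ⟨h, hw⟩, rfl⟩
        exact ⟨w, hw, h⟩
    rw [this]
    refine measurableSet_image_of_countable_fibres measurable_fst
      (hG.measurableSet.inter (measurable_snd ih)) fun z => ?_
    refine ((hS.countable z).image (Prod.mk z)).mono ?_
    rintro ⟨z', w⟩ ⟨⟨h, -⟩, rfl⟩
    exact ⟨w, (hG.reachable_iff _ _).1 (SimpleGraph.Adj.reachable h), rfl⟩

/-- A Borel map moving every point along an edge of the treeing towards a complete section. -/
theorem exists_measurable_parent (hS : IsCountableBorel S) {G : SimpleGraph Z}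
    (hG : IsTreeing S G) (hs : Measurable s) (hi : Function.Injective s)
    (hc : ∀ z, ∃ x, S z (s x)) :
    ∃ p : Z → Z, Measurable p ∧ (∀ x, p (s x) = s x) ∧ (∀ z, p z = z ∨ G.Adj z (p z)) ∧
      ∀ z, ∃ x n, p^[n] z = s x := by
  have hL := measurableSet_level hS hG hs hi
  have hcover : ∀ z, ∃ n, z ∈ level G s n := by
    intro z
    obtain ⟨x, hx⟩ := hc z
    have hr := (hG.reachable_iff _ _).2 (S.symm hx)
    rw [SimpleGraph.reachable_iff_reflTransGen] at hr
    induction hr with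
    | refl => exact ⟨0, x, rfl⟩
    | @tail b c hab hbc ih =>
      obtain ⟨n, hn⟩ := ih ((hG.reachable_iff _ _).1
        ((SimpleGraph.reachable_iff_reflTransGen _ _).2 hab).symm)
      exact ⟨n + 1, Or.inr ⟨b, hn, hbc.symm⟩⟩
  -- Off the section, `P` offers a neighbour in some level not containing the point, so every move
  -- strictly lowers the level.
  set P : Set (Z × Z) := {q | q.1 ∈ level G s 0 ∧ q.2 = q.1} ∪
    ⋃ n, {q | q.1 ∉ level G s n ∧ q.2 ∈ level G s n ∧ G.Adj q.1 q.2} with hP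
  have hPm : MeasurableSet P := by
    refine MeasurableSet.union ?_ (MeasurableSet.iUnion fun n => ?_)
    · exact (measurable_fst (hL 0)).inter (measurableSet_eq_fun measurable_snd measurable_fst)
    · exact (measurable_fst (hL n)).compl.inter ((measurable_snd (hL n)).inter hG.measurableSet)
  obtain ⟨p, hpm, hp⟩ := exists_measurable_uniformization hPm
    (fun z => by
      refine (hS.countable z).mono ?_
      rintro w (⟨-, h⟩ | h)
      · have h : w = z := h
        subst h
        exact S.refl w
      · obtain ⟨n, -, -, h⟩ := mem_iUnion.1 h
        exact (hG.reachable_iff _ _).1 (SimpleGraph.Adj.reachable h))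
    (fun z => by
      classical
      have hspec := Nat.find_spec (hcover z)
      have hmin := fun m => Nat.find_min (m := m) (hcover z)
      rcases hn : Nat.find (hcover z) with _ | n
      · rw [hn] at hspec
        exact ⟨z, Or.inl ⟨hspec, rfl⟩⟩
      · rw [hn] at hspec hmin
        rcases hspec with h | ⟨w, hw, hzw⟩
        · exact absurd h (hmin n n.lt_succ_self)
        · exact ⟨w, Or.inr (mem_iUnion.2 ⟨n, hmin n n.lt_succ_self, hw, hzw⟩)⟩)
  have hfix : ∀ x, p (s x) = s x := by
    intro x
    rcases hp (s x) with h | h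
    · exact h.2
    · obtain ⟨n, hn, -⟩ := mem_iUnion.1 h
      exact absurd (level_mono G s (Nat.zero_le n) ⟨x, rfl⟩) hn
  refine ⟨p, hpm, hfix, fun z => ?_, fun z => ?_⟩
  · rcases hp z with h | h
    · exact Or.inl h.2
    · obtain ⟨n, -, -, h⟩ := mem_iUnion.1 h
      exact Or.inr h
  · obtain ⟨n, hn⟩ := hcover z
    induction n generalizing z with
    | zero =>
      obtain ⟨x, rfl⟩ := hn
      exact ⟨x, 0, rfl⟩
    | succ n ih =>
      rcases hp z with ⟨h, -⟩ | h
      · obtain ⟨x, rfl⟩ := h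
        exact ⟨x, 0, rfl⟩
      · obtain ⟨m, hm, hm', -⟩ := mem_iUnion.1 h
        have hmn : m ≤ n := by
          by_contra hlt
          exact hm (level_mono G s (by omega) hn)
        obtain ⟨x, k, hk⟩ := ih (p z) (level_mono G s hmn hm')
        exact ⟨x, k + 1, hk⟩

/-- Treeability passes to complete Borel sections. -/
theorem IsTreeable.comap (hS : IsCountableBorel S) (h : IsTreeable S) (hs : Measurable s)
    (hi : Function.Injective s) (hc : ∀ z, ∃ x, S z (s x)) : IsTreeable (S.comap s) := by
  obtain ⟨G, hG⟩ := h
  obtain ⟨p, hpm, hfix, hp, hex⟩ := exists_measurable_parent hS hG hs hi hc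
  choose ρ hρ using hex
  have hfixn : ∀ n x, p^[n] (s x) = s x := fun n x => Function.iterate_fixed (hfix x) n
  -- The section is fixed by `p`, so further iteration does not change the endpoint.
  have huniq : ∀ {z x n}, p^[n] z = s x → ρ z = x := by
    intro z x n hn
    obtain ⟨m, hm⟩ := hρ z
    apply hi
    rw [← hfixn n (ρ z), ← hfixn m x, ← hm, ← hn, ← Function.iterate_add_apply,
      ← Function.iterate_add_apply, add_comm]
  have hρs : ∀ x, ρ (s x) = x := fun x => huniq (n := 0) rfl
  have hρp : ∀ z, ρ (p z) = ρ z := by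
    intro z
    obtain ⟨n, hn⟩ := hρ z
    refine huniq (n := n) ?_
    rw [← Function.iterate_succ_apply, Function.iterate_succ_apply', hn, hfix]
  have hpath : ∀ n z, Relation.ReflTransGen (fun c d => G.Adj c d ∧ ρ c = ρ d) z (p^[n] z) := by
    intro n
    induction n with
    | zero => exact fun z => .refl
    | succ n ih =>
      intro z
      rw [Function.iterate_succ_apply]
      refine Relation.ReflTransGen.trans ?_ (ih (p z))
      rcases hp z with h | h
      · rw [h]
      · exact .single ⟨h, (hρp z).symm⟩
  have hsymm : Std.Symm (fun c d => G.Adj c d ∧ ρ c = ρ d) :=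
    ⟨fun c d h => ⟨h.1.symm, h.2.symm⟩⟩
  have hfib : ∀ a b, ρ a = ρ b →
      Relation.ReflTransGen (fun c d => G.Adj c d ∧ ρ c = ρ d) a b := by
    intro a b hab
    obtain ⟨n, hn⟩ := hρ a
    obtain ⟨m, hm⟩ := hρ b
    have ha := hpath n a
    have hb := hpath m b
    rw [hn] at ha
    rw [hm, ← hab] at hb
    exact ha.trans (Relation.ReflTransGen.stdSymm.symm _ _ hb)
  have hfib' : ∀ a b, ρ a = ρ b → G.Reachable a b := fun a b hab =>
    (SimpleGraph.reachable_iff_reflTransGen _ _).2 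
      (Relation.ReflTransGen.mono (fun _ _ h => h.1) _ _ (hfib a b hab))
  have hρm : Measurable ρ := by
    refine measurable_of_measurableSet_graph ?_
    have hm : MeasurableSet (⋃ n, {q : Z × X | p^[n] q.1 = s q.2}) :=
      MeasurableSet.iUnion fun n => measurableSet_eq_fun ((hpm.iterate n).comp measurable_fst)
        (hs.comp measurable_snd)
    refine (congrArg MeasurableSet (Set.ext ?_)).mpr hm
    rintro ⟨z, x⟩
    rw [mem_iUnion]
    constructor
    · rintro (rfl : x = ρ z)
      exact hρ z
    · rintro ⟨n, hn⟩
      exact (huniq hn).symm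
  have hSρ : ∀ z, S z (s (ρ z)) := fun z =>
    (hG.reachable_iff _ _).1 (hfib' _ _ (hρs (ρ z)).symm)
  refine ⟨contraction G ρ, ?_, fun x y => ?_, contraction_isAcyclic hG.isAcyclic hfib⟩
  · have heq : {q : X × X | (contraction G ρ).Adj q.1 q.2} = {q | q.1 = q.2}ᶜ ∩
        (fun q : Z × Z => (ρ q.1, ρ q.2)) '' {q | G.Adj q.1 q.2} := by
      ext ⟨x, y⟩
      constructor
      · rintro ⟨hne, a, b, hab, rfl, rfl⟩
        exact ⟨hne, (a, b), hab, rfl⟩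
      · rintro ⟨hne, ⟨a, b⟩, hab, he⟩
        rw [Prod.mk.injEq] at he
        exact ⟨hne, a, b, hab, he.1, he.2⟩
    rw [heq]
    refine (measurableSet_eq_fun measurable_fst measurable_snd).compl.inter ?_
    refine measurableSet_image_of_countable_fibres
      ((hρm.comp measurable_fst).prodMk (hρm.comp measurable_snd)) hG.measurableSet ?_
    rintro ⟨x, y⟩
    refine ((hS.countable (s x)).prod (hS.countable (s y))).mono ?_
    rintro ⟨a, b⟩ ⟨-, he⟩
    rw [mem_preimage, mem_singleton_iff, Prod.mk.injEq] at he
    obtain ⟨rfl, rfl⟩ := he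
    exact ⟨S.symm (hSρ a), S.symm (hSρ b)⟩
  · have := contraction_reachable_iff hfib' (s x) (s y)
    rw [hρs, hρs, hG.reachable_iff] at this
    exact this

end Restriction

end BorelTrees

namespace BorelTrees

/-! ### From a smooth arboretum to a treeing. -/

namespace RSpace

variable {X : Type u} [MeasurableSpace X] {R : Setoid X} (F : RSpace R)

theorem orbitRel_act {x : X} (v : F.carrier) (h : R x (F.proj v)) :
    F.orbitRel (F.act x (F.proj v) v h rfl) v := by
  have key : ∀ w, F.proj w = x → w = F.act x (F.proj v) v h rfl → F.orbitRel w v := by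
    rintro w rfl hw
    exact ⟨h, hw.symm⟩
  exact key _ (F.proj_act ..) rfl

theorem orbitRel_iff_act_eq {x : X} {v w : F.carrier} (hv : R x (F.proj v))
    (hw : R x (F.proj w)) :
    F.orbitRel v w ↔ F.act x (F.proj v) v hv rfl = F.act x (F.proj w) w hw rfl := by
  constructor
  · rintro ⟨k, e⟩
    have := F.act_act x (F.proj v) (F.proj w) w hv k rfl
    simpa only [e] using this
  · intro e
    refine F.orbitRel.trans (F.orbitRel.symm (F.orbitRel_act v hv)) ?_
    rw [e]
    exact F.orbitRel_act w hw

end RSpace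

namespace GraphField

variable {X : Type u} [MeasurableSpace X] {R : Setoid X} (A : GraphField R)

theorem terminus_rev (e : A.edge.carrier) : A.terminus (A.rev e) = A.origin e := by
  rw [← A.origin_rev, A.rev_rev]

/-- The graph on the vertex space in which a transversal `D` of the orbits carries the quotient
graph, and every other vertex is joined to the representative of its orbit. -/
def transversalGraph (D : Set A.vert.carrier) : SimpleGraph A.vert.carrier where
  Adj v w := v ≠ w ∧ ((v ∉ D ∧ w ∈ D ∧ A.vert.orbitRel v w) ∨
    (w ∉ D ∧ v ∈ D ∧ A.vert.orbitRel w v) ∨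
    (v ∈ D ∧ w ∈ D ∧ ∃ e, A.vert.orbitRel (A.origin e) v ∧ A.vert.orbitRel (A.terminus e) w))
  symm := ⟨by
    rintro v w ⟨hne, h | h | ⟨hv, hw, e, h₁, h₂⟩⟩
    · exact ⟨hne.symm, Or.inr (Or.inl h)⟩
    · exact ⟨hne.symm, Or.inl h⟩
    · refine ⟨hne.symm, Or.inr (Or.inr ⟨hw, hv, A.rev e, ?_, ?_⟩)⟩
      · rwa [A.origin_rev]
      · rwa [A.terminus_rev]⟩
  loopless := ⟨fun _ h => h.1 rfl⟩

variable {A} {D : Set A.vert.carrier}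

/-- The quantifier over edges is a countable-to-one projection: the origin of a suitable `e` lies in
the countable orbit of `v`, and edge fibres are countable. -/
theorem measurableSet_transversalGraph (hR : IsCountableBorel R) (hD : MeasurableSet D) :
    MeasurableSet {p : A.vert.carrier × A.vert.carrier |
      (A.transversalGraph D).Adj p.1 p.2} := by
  have hO := (A.vert.isCountableBorel_orbitRel hR)
  have hleaf : MeasurableSet {p : A.vert.carrier × A.vert.carrier |
      p.1 ∉ D ∧ p.2 ∈ D ∧ A.vert.orbitRel p.1 p.2} :=
    (measurable_fst hD).compl.inter ((measurable_snd hD).inter hO.measurableSet)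
  have hleaf' : MeasurableSet {p : A.vert.carrier × A.vert.carrier |
      p.2 ∉ D ∧ p.1 ∈ D ∧ A.vert.orbitRel p.2 p.1} := measurable_swap hleaf
  have hne : MeasurableSet {p : A.vert.carrier × A.vert.carrier | p.1 ≠ p.2} :=
    (measurableSet_eq_fun measurable_fst measurable_snd).compl
  set Q : Set (A.edge.carrier × A.vert.carrier × A.vert.carrier) :=
    {q | A.vert.orbitRel (A.origin q.1) q.2.1 ∧ A.vert.orbitRel (A.terminus q.1) q.2.2} with hQ
  have hQm : MeasurableSet Q := by
    refine MeasurableSet.inter ?_ ?_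
    · exact ((A.origin_morphism.measurable.comp measurable_fst).prodMk
        (measurable_fst.comp measurable_snd)) hO.measurableSet
    · exact ((A.terminus_morphism.measurable.comp measurable_fst).prodMk
        (measurable_snd.comp measurable_snd)) hO.measurableSet
  have himg : MeasurableSet (Prod.snd '' Q) := by
    refine measurableSet_image_of_countable_fibres measurable_snd hQm ?_
    rintro ⟨v, w⟩
    have hc : (⋃ u ∈ {u | A.vert.orbitRel v u}, A.edge.proj ⁻¹' {A.vert.proj u}).Countable :=
      (hO.countable v).biUnion fun u _ => A.edge.countable_fibre _
    refine (hc.image fun e => (e, v, w)).mono ?_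
    rintro ⟨e, v', w'⟩ ⟨⟨h, -⟩, he⟩
    have he : (v', w') = (v, w) := he
    rw [Prod.mk.injEq] at he
    obtain ⟨rfl, rfl⟩ := he
    refine ⟨e, mem_biUnion (A.vert.orbitRel.symm h) ?_, rfl⟩
    exact (A.origin_morphism.proj_eq e).symm
  have hmain := hne.inter (hleaf.union (hleaf'.union
    ((measurable_fst hD).inter ((measurable_snd hD).inter himg))))
  refine (congrArg MeasurableSet (Set.ext ?_)).mpr hmain
  rintro ⟨v, w⟩
  constructor
  · rintro ⟨hne, h | h | ⟨hv, hw, e, h⟩⟩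
    · exact ⟨hne, Or.inl h⟩
    · exact ⟨hne, Or.inr (Or.inl h)⟩
    · exact ⟨hne, Or.inr (Or.inr ⟨hv, hw, (e, v, w), h, rfl⟩)⟩
  · rintro ⟨hne, h | h | ⟨hv, hw, ⟨e, v', w'⟩, h, he⟩⟩
    · exact ⟨hne, Or.inl h⟩
    · exact ⟨hne, Or.inr (Or.inl h)⟩
    · have he : (v', w') = (v, w) := he
      rw [Prod.mk.injEq] at he
      obtain ⟨rfl, rfl⟩ := he
      exact ⟨hne, Or.inr (Or.inr ⟨hv, hw, e, h⟩)⟩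

theorem rel_of_transversalGraph_adj {v w : A.vert.carrier}
    (h : (A.transversalGraph D).Adj v w) : R (A.vert.proj v) (A.vert.proj w) := by
  obtain ⟨-, ⟨-, -, h, -⟩ | ⟨-, -, h, -⟩ | ⟨-, -, e, ⟨h, -⟩, ⟨h', -⟩⟩⟩ := h
  · exact h
  · exact R.symm h
  · rw [A.origin_morphism.proj_eq] at h
    rw [A.terminus_morphism.proj_eq] at h'
    exact R.trans (R.symm h) h'

/-- The translate of `w` into the tree over `proj v` has the same representative as `w`, and a path
in this tree projects to a path of representatives. -/
theorem transversalGraph_reachable_iff (hA : A.IsArboretum)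
    (hD : ∀ y, ∃! d, d ∈ D ∧ A.vert.orbitRel y d) (v w : A.vert.carrier) :
    (A.transversalGraph D).Reachable v w ↔ R (A.vert.proj v) (A.vert.proj w) := by
  constructor
  · rintro ⟨p⟩
    induction p with
    | nil => exact R.refl _
    | cons h _ ih => exact R.trans (rel_of_transversalGraph_adj h) ih
  · intro h
    choose r hr hr' using fun y => (hD y).exists
    have hreach : ∀ a, (A.transversalGraph D).Reachable a (r a) := by
      intro a
      by_cases ha : a ∈ D
      · rw [(hD a).unique ⟨hr a, hr' a⟩ ⟨ha, A.vert.orbitRel.refl a⟩]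
      · refine SimpleGraph.Adj.reachable ⟨?_, Or.inl ⟨ha, hr a, hr' a⟩⟩
        exact fun e => ha (e ▸ hr a)
    have hT := (hA.isTree (A.vert.proj v)).connected.preconnected ⟨v, rfl⟩
      ⟨A.vert.act _ _ w h rfl, A.vert.proj_act ..⟩
    have hmid := reachable_map (H := A.transversalGraph D) (φ := fun u => r u.1) (by
      rintro ⟨a, ha⟩ ⟨b, hb⟩ ⟨-, e, rfl, rfl⟩
      by_cases hab : r (A.origin e) = r (A.terminus e)
      · simp only [hab]; exact SimpleGraph.Reachable.refl _
      · exact SimpleGraph.Adj.reachable ⟨hab, Or.inr (Or.inr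
          ⟨hr _, hr _, e, hr' _, hr' _⟩)⟩) hT
    have hrw : r (A.vert.act _ _ w h rfl) = r w :=
      (hD w).unique ⟨hr _, A.vert.orbitRel.trans
        (A.vert.orbitRel.symm (A.vert.orbitRel_act w h)) (hr' _)⟩ ⟨hr w, hr' w⟩
    simp only [hrw] at hmid
    exact ((hreach v).trans hmid).trans (hreach w).symm

/-- The point `v` is a leaf: its only neighbour is its representative in `D`. -/
theorem transversalGraph_isBridge_of_notMem
    (hD : ∀ y, ∃! d, d ∈ D ∧ A.vert.orbitRel y d) {v w : A.vert.carrier} (hv : v ∉ D)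
    (hw : w ∈ D) (hvw : A.vert.orbitRel v w) : (A.transversalGraph D).IsBridge s(v, w) := by
  rw [SimpleGraph.isBridge_iff, SimpleGraph.reachable_iff_reflTransGen]
  intro h
  rcases h.cases_head with h | ⟨c, h, -⟩
  · exact hv (h ▸ hw)
  · rw [SimpleGraph.deleteEdges_adj] at h
    obtain ⟨⟨-, ⟨-, hc, h⟩ | ⟨-, h, -⟩ | ⟨h, -⟩⟩, hne⟩ := h
    · exact hne (by rw [(hD v).unique ⟨hc, h⟩ ⟨hw, hvw⟩]; rfl)
    · exact hv h
    · exact hv h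

/-- For an edge between points of `D`, translation into the tree over `x` collapses leaf edges,
sends edges within `D` to tree edges and is injective on the part of `D` over the class of `x`. A
walk bypassing the edge would thus bypass a bridge of that tree. -/
theorem transversalGraph_isAcyclic (hA : A.IsArboretum)
    (hD : ∀ y, ∃! d, d ∈ D ∧ A.vert.orbitRel y d) : (A.transversalGraph D).IsAcyclic := by
  rw [SimpleGraph.isAcyclic_iff_forall_adj_isBridge]
  rintro v w ⟨-, ⟨hv, hw, h⟩ | ⟨hw, hv, h⟩ | ⟨hv, hw, e, h₁, h₂⟩⟩
  · exact transversalGraph_isBridge_of_notMem hD hv hw h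
  · rw [Sym2.eq_swap]
    exact transversalGraph_isBridge_of_notMem hD hw hv h
  set x := A.edge.proj e with hx
  -- the translate of `a` into the fibre over `x`
  let M : ∀ a, R x (A.vert.proj a) → {u : A.vert.carrier // A.vert.proj u = x} := fun a h =>
    ⟨A.vert.act x _ a h rfl, A.vert.proj_act ..⟩
  have hM : ∀ {a b : A.vert.carrier} (ha : R x (A.vert.proj a)) (hb : R x (A.vert.proj b)),
      A.vert.orbitRel a b ↔ M a ha = M b hb := by
    intro a b ha hb
    rw [Subtype.ext_iff]
    exact A.vert.orbitRel_iff_act_eq ha hb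
  have hMD : ∀ {a b} (ha : R x (A.vert.proj a)) (hb : R x (A.vert.proj b)), a ∈ D → b ∈ D →
      M a ha = M b hb → a = b := fun {a b} ha hb haD hbD hab =>
    (hD a).unique ⟨haD, A.vert.orbitRel.refl a⟩ ⟨hbD, (hM ha hb).2 hab⟩
  have hadj : ∀ {a b} (ha : R x (A.vert.proj a)) (hb : R x (A.vert.proj b)) (e' : A.edge.carrier),
      A.vert.orbitRel (A.origin e') a → A.vert.orbitRel (A.terminus e') b →
      (A.fibreGraph x).Adj (M a ha) (M b hb) := by
    intro a b ha hb e' h₁ h₂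
    have ho : R x (A.vert.proj (A.origin e')) := R.trans ha (R.symm h₁.1)
    have ht : R x (A.vert.proj (A.terminus e')) := R.trans hb (R.symm h₂.1)
    have he' : R x (A.edge.proj e') := by rwa [A.origin_morphism.proj_eq] at ho
    have hcongr : ∀ (u : A.vert.carrier) y (hy : R x y) (hu : A.vert.proj u = y)
        (hu' : R x (A.vert.proj u)),
        A.vert.act x y u hy hu = A.vert.act x (A.vert.proj u) u hu' rfl := by
      rintro u y hy rfl hu'
      rfl
    have h3 : A.origin (A.edge.act x _ e' he' rfl) = (M a ha).1 := by
      rw [A.origin_morphism.map_act, ← (hM ho ha).1 h₁]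
      exact hcongr _ _ _ _ _
    have h4 : A.terminus (A.edge.act x _ e' he' rfl) = (M b hb).1 := by
      rw [A.terminus_morphism.map_act, ← (hM ht hb).1 h₂]
      exact hcongr _ _ _ _ _
    refine ⟨fun hab => hA.no_loop (A.edge.act x _ e' he' rfl) ?_, _, h3, h4⟩
    rw [h3, h4, hab]
  have hv' : R x (A.vert.proj v) := by
    have := h₁.1
    rwa [A.origin_morphism.proj_eq] at this
  have hw' : R x (A.vert.proj w) := by
    have := h₂.1
    rwa [A.terminus_morphism.proj_eq] at this
  have hbridge := SimpleGraph.isAcyclic_iff_forall_adj_isBridge.1 (hA.isTree x).isAcyclic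
    (hadj hv' hw' e h₁ h₂)
  rw [SimpleGraph.isBridge_iff] at hbridge ⊢
  intro hreach
  apply hbridge
  have key : ∀ b, Relation.ReflTransGen ((A.transversalGraph D).deleteEdges {s(v, w)}).Adj v b →
      ∃ hb, ((A.fibreGraph x).deleteEdges {s(M v hv', M w hw')}).Reachable (M v hv') (M b hb) := by
    intro b hvb
    induction hvb with
    | refl => exact ⟨hv', SimpleGraph.Reachable.refl _⟩
    | @tail b c _ hbc ih =>
      obtain ⟨hb, ih⟩ := ih
      rw [SimpleGraph.deleteEdges_adj] at hbc
      have hc : R x (A.vert.proj c) := R.trans hb (rel_of_transversalGraph_adj hbc.1)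
      refine ⟨hc, ih.trans ?_⟩
      obtain ⟨⟨-, ⟨-, -, h⟩ | ⟨-, -, h⟩ | ⟨hbD, hcD, e', h₁', h₂'⟩⟩, hne⟩ := hbc
      · rw [(hM hb hc).1 h]
      · rw [(hM hc hb).1 h]
      · refine SimpleGraph.Adj.reachable ?_
        rw [SimpleGraph.deleteEdges_adj]
        refine ⟨hadj hb hc e' h₁' h₂', fun hmem => hne ?_⟩
        rw [mem_singleton_iff, Sym2.eq_iff] at hmem ⊢
        rcases hmem with ⟨h, h'⟩ | ⟨h, h'⟩
        · exact Or.inl ⟨hMD _ _ hbD hv h, hMD _ _ hcD hw h'⟩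
        · exact Or.inr ⟨hMD _ _ hbD hw h, hMD _ _ hcD hv h'⟩
  obtain ⟨_, h⟩ := key w ((SimpleGraph.reachable_iff_reflTransGen _ _).1 hreach)
  exact h

/-- A relation with a smooth action on an arboretum is treeable. -/
theorem IsArboretum.isTreeable [StandardBorelSpace X] (hR : IsCountableBorel R)
    (hA : A.IsArboretum) (hs : A.vert.IsSmoothAction) : IsTreeable R := by
  obtain ⟨D, hD, hDu⟩ := hs
  have hS : IsCountableBorel (R.comap A.vert.proj) :=
    { measurableSet := ((A.vert.measurable_proj.comp measurable_fst).prodMk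
        (A.vert.measurable_proj.comp measurable_snd)) hR.measurableSet
      countable := fun v => by
        have : (⋃ y ∈ {y | R (A.vert.proj v) y}, A.vert.proj ⁻¹' {y}).Countable :=
          (hR.countable _).biUnion fun y _ => A.vert.countable_fibre y
        refine this.mono fun w hw => ?_
        exact mem_biUnion (show A.vert.proj w ∈ {y | R (A.vert.proj v) y} from hw) rfl }
  have hST : IsTreeable (R.comap A.vert.proj) :=
    ⟨A.transversalGraph D, measurableSet_transversalGraph hR hD,
      transversalGraph_reachable_iff hA hDu, transversalGraph_isAcyclic hA hDu⟩
  -- A Borel section of the projection meets every class of the pullback of `R`, and restricting the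
  -- pullback along it returns `R`.
  obtain ⟨s, hsm, hs⟩ := exists_measurable_uniformization
    (P := {p : X × A.vert.carrier | A.vert.proj p.2 = p.1})
    (measurableSet_eq_fun (A.vert.measurable_proj.comp measurable_snd) measurable_fst)
    A.vert.countable_fibre A.vert_surjective
  have hs : ∀ x, A.vert.proj (s x) = x := hs
  have := hST.comap hS hsm (fun x y h => by rw [← hs x, ← hs y, h])
    fun v => ⟨A.vert.proj v, by
      change R _ _
      rw [hs]⟩
  convert this
  ext x y
  change R x y ↔ R (A.vert.proj (s x)) (A.vert.proj (s y))
  rw [hs, hs]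

end GraphField

end BorelTrees

/-- A countable Borel equivalence relation on a standard Borel space is treeable if and only if it
acts quasi-freely on an arboretum; moreover an action of it on a standard fibre space is
quasi-free if and only if it is smooth. -/
theorem mainTheorem3 {X : Type u} [MeasurableSpace X] [StandardBorelSpace X] (R : Setoid X)
    (hR : BorelTrees.IsCountableBorel R) :
    (BorelTrees.IsTreeable R ↔
      ∃ A : BorelTrees.GraphField R, A.IsArboretum ∧ A.IsQuasiFree) ∧
    (∀ F : BorelTrees.RSpace R, F.IsQuasiFree ↔ F.IsSmoothAction) := by
  refine ⟨⟨?_, ?_⟩, BorelTrees.RSpace.isQuasiFree_iff_isSmoothAction hR⟩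
  · rintro ⟨G, hG⟩
    exact ⟨BorelTrees.treeingField hR hG, BorelTrees.treeingField_isArboretum hR hG,
      (BorelTrees.leftSpace_isSmoothAction hR).isQuasiFree hR⟩
  · rintro ⟨A, hA, hq⟩
    exact hA.isTreeable hR (BorelTrees.RSpace.IsQuasiFree.isSmoothAction hR hq)
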